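/- **Definitions.** All alphabets are finite. A signature is a finite label set $\Sigma$ with a function $\mathrm{type}:\Sigma\to\mathbb{N}$. A hypergraph $H$ over it consists of finite sets $V_H$ of nodes and $E_H$ of hyperedges, functions $\mathrm{att}_H:E_H\to V_H^*$ and $\mathrm{lab}_H:E_H\to\Sigma$ with $|\mathrm{att}_H(e)|=\mathrm{type}(\mathrm{lab}_H(e))$ for all $e$, and a sequence $\mathrm{ext}_H\in V_H^*$ of external nodes; $\mathrm{type}(H)=|\mathrm{ext}_H|$, and $H$ is repetition-free if $\mathrm{ext}_H$ has no repeated node. Isomorphisms preserve attachments, labels and the sequence of external nodes. The handle $X^\bullet$ of a label $X$ of type $n$ has nodes $v_1,\dots,v_n$, external nodes $v_1\cdots v_n$ and one hyperedge, labelled $X$ and attached to $v_1\cdots v_n$. The string graph of $x_1\cdots x_n$ (labels of type $2$) has nodes $v_0,\dots,v_n$, external nodes $v_0v_n$, and hyperedges $e_1,\dots,e_n$ with $\mathrm{lab}(e_i)=x_i$ and $\mathrm{att}(e_i)=v_{i-1}v_i$; any hypergraph isomorphic to it is a string graph representing $x_1\cdots x_n$. A rule is a pair $(X,R)$ of a label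 $X$ and a hypergraph $R$ with $\mathrm{type}(X)=\mathrm{type}(R)$; its type is $\mathrm{type}(X)$, and it is repetition-free if $R$ is. A table is a finite set of rules that contains at least one rule $(X,R)$ for each $X\in\Sigma$. Write $H\Rrightarrow_T H'$ if $H'$ is isomorphic to a hypergraph obtained from $H$ by choosing for every hyperedge $e$ of $H$ a rule $(\mathrm{lab}_H(e),R_e)\in T$, removing all hyperedges of $H$, disjointly adding all $R_e$, and identifying the $i$-th external node of $R_e$ with the $i$-th attachment node of $e$ for all $e$ and $i$ (the external nodes are those of $H$). A $(k,l)$-PHR grammar (parallel hyperedge replacement grammar of order $k$ with at most $l$ tables) consists of a signature, a set $A\subseteq\Sigma$ of terminals, a start symbol $S\in\Sigma$, and a non-empty set of at most $l$ tables all of whose rules have type at most $k$; it is repetition-free if all its rules are. It generates all hypergraphs $H$ with labels in $A$ only that are isomorphic to $S^\bullet$ or can be reached from $S^\bullet$ by finitely many steps $\Rrightarrow_T$, with any table $T$ of the grammar in each step. A string language $L$ is a (repetition-free) $(k,l)$-PHRS language if some (repetition-free) $(k,l)$-PHR grammar generates only string graphs, and the set of strings that these represent is $L\setminus\{\epsilon\}$.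 **Theorem (PHRS closed under rational intersection).** Let $k\ge 2$ and $l\ge 1$, let $L\subseteq A^*$ be a string language and let $K\subseteq B^*$ be a regular language, where $A$ and $B$ are alphabets. If $L$ is a $(k,l)$-PHRS language, then $L\cap K$ is a $(k,l)$-PHRS language. If $L$ is a repetition-free $(k,l)$-PHRS language, then $L\cap K$ is a repetition-free $(k,l)$-PHRS language. -/

import Mathlib

/-- A signature: a finite label set together with a typing (arity) function. -/
structure Signature where
  Label : Type
  [finiteLabel : Finite Label]
  type : Label → ℕ

/-- A (finite) hypergraph over a signature: nodes, hyperedges, attachment, labelling and a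
sequence of external nodes, such that the type of the label of every hyperedge is the length of
its attachment sequence. -/
structure LabelledHypergraph (C : Signature) where
  V : Type
  E : Type
  [finiteV : Finite V]
  [finiteE : Finite E]
  att : E → List V
  lab : E → C.Label
  ext : List V
  type_lab : ∀ e, C.type (lab e) = (att e).length

attribute [instance] Signature.finiteLabel LabelledHypergraph.finiteV LabelledHypergraph.finiteE

namespace LabelledHypergraph

variable {C : Signature}

/-- The type of a hypergraph is the number of its external nodes (counted with repetition). -/
def type (H : LabelledHypergraph C) : ℕ := H.ext.length

/-- A hypergraph is repetition-free if no node occurs twice among the external nodes. -/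
def RepetitionFree (H : LabelledHypergraph C) : Prop := H.ext.Nodup

/-- Isomorphism of hypergraphs: bijections on nodes and hyperedges that preserve attachments,
labels and the sequence of external nodes. -/
def Isomorphic (G H : LabelledHypergraph C) : Prop :=
  ∃ (fV : G.V ≃ H.V) (fE : G.E ≃ H.E),
    (∀ e, H.att (fE e) = (G.att e).map fV) ∧
    (∀ e, H.lab (fE e) = G.lab e) ∧
    H.ext = G.ext.map fV

/-- The handle of a label `X` of type `n`: nodes `v₁, …, vₙ`, one hyperedge labelled `X` and
attached to `v₁ ⋯ vₙ`, and external nodes `v₁ ⋯ vₙ`. -/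
def handle (X : C.Label) : LabelledHypergraph C where
  V := Fin (C.type X)
  E := Unit
  att _ := List.finRange (C.type X)
  lab _ := X
  ext := List.finRange (C.type X)
  type_lab _ := by simp

/-- The string graph of a string `w = x₁ ⋯ xₙ` of labels of type `2`: nodes `v₀, …, vₙ`,
hyperedges `e₁, …, eₙ` with `eᵢ` labelled `xᵢ` and attached to `vᵢ₋₁ vᵢ`, and external nodes
`v₀ vₙ`. -/
def stringGraph (w : List C.Label) (hw : ∀ x ∈ w, C.type x = 2) : LabelledHypergraph C where
  V := Fin (w.length + 1)
  E := Fin w.length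
  att i := [i.castSucc, i.succ]
  lab i := w.get i
  ext := [0, Fin.last w.length]
  type_lab i := by simpa using hw _ (List.get_mem w i)

/-- `H` is a string graph representing the string `w`. -/
def Represents (H : LabelledHypergraph C) (w : List C.Label) : Prop :=
  ∃ hw : ∀ x ∈ w, C.type x = 2, H.Isomorphic (stringGraph w hw)

/-- The identifications made by a replacement: the `i`-th attachment node of `e` is identified
with the `i`-th external node of `σ e`. -/
inductive Glue (H : LabelledHypergraph C) (σ : H.E → LabelledHypergraph C) :
    H.V ⊕ (Σ e, (σ e).V) → H.V ⊕ (Σ e, (σ e).V) → Prop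
  | glue (e : H.E) (i : ℕ) (hi : i < (H.att e).length) (hi' : i < (σ e).ext.length) :
      Glue H σ (Sum.inl (H.att e)[i]) (Sum.inr ⟨e, (σ e).ext[i]⟩)

/-- The replacement `H[e₁/σ(e₁), …, eₙ/σ(eₙ)]` of *all* hyperedges `e₁, …, eₙ` of `H`: the
hyperedges of `H` are removed, the nodes and hyperedges of all `σ e` are disjointly added, and
the nodes are identified along `Glue` (`Quot` is the quotient by the generated equivalence
relation). It is used only where `σ e` has the type of `e`, for every `e`. -/
def replace (H : LabelledHypergraph C) (σ : H.E → LabelledHypergraph C) : LabelledHypergraph C where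
  V := Quot (Glue H σ)
  E := Σ e, (σ e).E
  att x := ((σ x.1).att x.2).map fun v => Quot.mk _ (Sum.inr ⟨x.1, v⟩)
  lab x := (σ x.1).lab x.2
  ext := H.ext.map fun v => Quot.mk _ (Sum.inl v)
  type_lab x := by simpa using (σ x.1).type_lab x.2

end LabelledHypergraph

/-- A table: a finite set of type-respecting rules `(X, R)` in which every label has a rule. -/
structure Table (C : Signature) where
  rules : Set (C.Label × LabelledHypergraph C)
  finite_rules : rules.Finite
  typed : ∀ r ∈ rules, C.type r.1 = r.2.type
  total : ∀ X : C.Label, ∃ R : LabelledHypergraph C, (X, R) ∈ rules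

/-- Parallel direct derivation with the table `T`: every hyperedge of `H` is replaced
by the right-hand side of some rule of `T` for its label. -/
def ParallelStep {C : Signature} (T : Table C) (H H' : LabelledHypergraph C) : Prop :=
  ∃ σ : H.E → LabelledHypergraph C, (∀ e, (H.lab e, σ e) ∈ T.rules) ∧ H'.Isomorphic (H.replace σ)

/-- Parallel derivation with a set of tables: an isomorphism, or a sequence of one or more
parallel direct derivations, each one with some table of the set. -/
def ParallelDerives {C : Signature} (𝒯 : Set (Table C)) (H H' : LabelledHypergraph C) : Prop :=
  H.Isomorphic H' ∨ Relation.TransGen (fun G G' => ∃ T ∈ 𝒯, ParallelStep T G G') H H'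

/-- A parallel hyperedge replacement (PHR) grammar: a signature, a set of terminal labels, a
start symbol, and a non-empty finite set of tables. -/
structure PHRGrammar where
  sig : Signature
  terminals : Set sig.Label
  start : sig.Label
  tables : Set (Table sig)
  finite_tables : tables.Finite
  nonempty_tables : tables.Nonempty

namespace PHRGrammar

/-- `G` is a `(k, l)`-PHR grammar: it has order (at most) `k` and uses at most `l` tables. -/
def IsOfOrder (G : PHRGrammar) (k l : ℕ) : Prop :=
  (∀ T ∈ G.tables, ∀ r ∈ T.rules, r.2.type ≤ k) ∧ G.tables.ncard ≤ l

/-- All rules of all tables of `G` have repetition-free right-hand sides. -/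
def RepetitionFree (G : PHRGrammar) : Prop :=
  ∀ T ∈ G.tables, ∀ r ∈ T.rules, r.2.RepetitionFree

/-- The hypergraph language generated by `G`: all hypergraphs with only terminal labels that
are derivable from the handle of the start symbol. -/
def language (G : PHRGrammar) : Set (LabelledHypergraph G.sig) :=
  {H | ParallelDerives G.tables (LabelledHypergraph.handle G.start) H ∧ ∀ e, H.lab e ∈ G.terminals}

/-- `G` generates a string graph language: every generated hypergraph is a string graph. -/
def GeneratesStringGraphs (G : PHRGrammar) : Prop :=
  ∀ H ∈ G.language, ∃ w, H.Represents w

/-- The strings represented by the hypergraphs that `G` generates. -/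
def STR (G : PHRGrammar) : Set (List G.sig.Label) :=
  {w | ∃ H ∈ G.language, H.Represents w}

/-- `G` generates the string language `L` over `α` up to the empty string, when its terminals are
read as symbols of `α` through some injection: `G` generates a string graph language, and the
strings so represented (all of them consist of terminals) are the non-empty strings of `L`. -/
def GeneratesStrings {α : Type*} (G : PHRGrammar) (L : Language α) : Prop :=
  G.GeneratesStringGraphs ∧
    ∃ name : G.terminals ↪ α,
      {w : List α | ∃ v : List G.terminals, v.map Subtype.val ∈ G.STR ∧ v.map name = w} =
        {w : List α | w ∈ L ∧ w ≠ []}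

end PHRGrammar

/-- `L` is a `(k, l)`-PHRS language: a parallel hyperedge replacement string language of order `k`
with at most `l` tables. -/
def IsPHRS {α : Type*} (k l : ℕ) (L : Language α) : Prop :=
  ∃ G : PHRGrammar, G.IsOfOrder k l ∧ G.GeneratesStrings L

/-- `L` is a repetition-free `(k, l)`-PHRS language. -/
def IsRepetitionFreePHRS {α : Type*} (k l : ℕ) (L : Language α) : Prop :=
  ∃ G : PHRGrammar, G.IsOfOrder k l ∧ G.RepetitionFree ∧ G.GeneratesStrings L

/-! A run of an automaton for the regular language on a generated string is an assignment of states
to the nodes of its string graph. During a derivation nodes are never deleted, only glued, so such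
an assignment pulls back to every earlier hypergraph. If each hyperedge carries in its label the
states at its attachment nodes, consistency of the assignment becomes a condition on single rules. A
new start label spends one extra step on guessing the states of the external nodes. The right-hand
sides change only in their labels, the added rules produce handles, and each table yields one table,
so order, number of tables and repetition-freeness survive.

The difficulty is parallelism: terminals are rewritten too, and every table needs a rule for every
label. Each label therefore has a `state` version, rewritten as before, and a `plain` version, which
alone can be terminal and whose only successor is a `dead` handle. A derivation of a terminal
hypergraph can thus introduce plain labels only in its last step.
`Table.hasDead_or_of_parallelStep_annotated` projects steps to the given grammar,
`Table.exists_parallelStep_annotated` lifts them backwards, and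
`PHRGrammar.mem_language_annotated_iff` combines both; `Represents.labelledPath_iff` turns node
assignments into runs. -/

namespace LabelledHypergraph

/-! ### Relabelling, isomorphism and replacement. -/

variable {C D : Signature}

/-- The hypergraph `H` with its hyperedges relabelled by `g`. -/
def relabel (H : LabelledHypergraph C) (g : H.E → D.Label)
    (hg : ∀ e, D.type (g e) = (H.att e).length) : LabelledHypergraph D where
  V := H.V
  E := H.E
  att := H.att
  lab := g
  ext := H.ext
  type_lab := hg

/-- Relabelling along a type-preserving map of labels. -/
def mapLabel (φ : C.Label → D.Label) (hφ : ∀ X, D.type (φ X) = C.type X)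
    (H : LabelledHypergraph C) : LabelledHypergraph D :=
  H.relabel (fun e => φ (H.lab e)) fun e => (hφ _).trans (H.type_lab e)

theorem Isomorphic.refl (H : LabelledHypergraph C) : H.Isomorphic H :=
  ⟨Equiv.refl _, Equiv.refl _, by simp, by simp, by simp⟩

theorem Isomorphic.symm {G H : LabelledHypergraph C} (h : G.Isomorphic H) : H.Isomorphic G := by
  obtain ⟨fV, fE, h1, h2, h3⟩ := h
  refine ⟨fV.symm, fE.symm, fun e => ?_, fun e => ?_, ?_⟩
  · simpa using congrArg (List.map fV.symm) (h1 (fE.symm e)).symm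
  · simpa using (h2 (fE.symm e)).symm
  · simp [h3]

theorem Isomorphic.trans {G H K : LabelledHypergraph C} (h : G.Isomorphic H)
    (h' : H.Isomorphic K) : G.Isomorphic K := by
  obtain ⟨fV, fE, h1, h2, h3⟩ := h
  obtain ⟨gV, gE, k1, k2, k3⟩ := h'
  exact ⟨fV.trans gV, fE.trans gE, by simp [h1, k1], by simp [h2, k2], by simp [h3, k3]⟩

theorem Isomorphic.mapLabel {G H : LabelledHypergraph C} (h : G.Isomorphic H)
    (φ : C.Label → D.Label) (hφ : ∀ X, D.type (φ X) = C.type X) :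
    (G.mapLabel φ hφ).Isomorphic (H.mapLabel φ hφ) := by
  obtain ⟨fV, fE, h1, h2, h3⟩ := h
  exact ⟨fV, fE, h1, fun e => congrArg φ (h2 e), h3⟩

theorem relabel_isomorphic {G : LabelledHypergraph C} {H : LabelledHypergraph D}
    (fV : G.V ≃ H.V) (fE : G.E ≃ H.E) (hatt : ∀ e, H.att (fE e) = (G.att e).map fV)
    (hext : H.ext = G.ext.map fV) (hg) :
    (G.relabel (fun e => H.lab (fE e)) hg).Isomorphic H :=
  ⟨fV, fE, hatt, fun _ => rfl, hext⟩

theorem relabel_eq_self (R : LabelledHypergraph C) (g : R.E → C.Label) (hg) (h : g = R.lab) :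
    R.relabel g hg = R := by
  subst h
  rfl

theorem mapLabel_relabel (R : LabelledHypergraph C) (φ : D.Label → C.Label)
    (hφ : ∀ X, C.type (φ X) = D.type X) (g : R.E → D.Label) (hg) (h : ∀ e, φ (g e) = R.lab e) :
    (R.relabel g hg).mapLabel φ hφ = R :=
  relabel_eq_self R _ _ (funext h)

/-- An isomorphism onto a relabelled hypergraph lifts to the hypergraph itself. -/
theorem exists_lift_of_isomorphic_mapLabel {R : LabelledHypergraph C} {H : LabelledHypergraph D}
    (φ : D.Label → C.Label) (hφ : ∀ X, C.type (φ X) = D.type X)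
    (h : R.Isomorphic (H.mapLabel φ hφ)) :
    ∃ R' : LabelledHypergraph D, R'.mapLabel φ hφ = R ∧ R'.Isomorphic H := by
  obtain ⟨fV, fE, h1, h2, h3⟩ := h
  refine ⟨R.relabel (fun e => H.lab (fE e)) fun e => ?_, ?_,
    relabel_isomorphic (H := H) fV fE h1 h3 _⟩
  · have := congrArg List.length (h1 e)
    rw [List.length_map] at this
    rw [← this]
    exact H.type_lab _
  · exact mapLabel_relabel _ _ _ _ _ h2

theorem glue_relabel_iff (H : LabelledHypergraph C) (σ : H.E → LabelledHypergraph C)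
    (g : H.E → D.Label) (hg) (h : ∀ e, (σ e).E → D.Label)
    (hh : ∀ e x, D.type (h e x) = ((σ e).att x).length) (x y : H.V ⊕ Σ e, (σ e).V) :
    Glue H σ x y ↔ Glue (H.relabel g hg) (fun e => (σ e).relabel (h e) (hh e)) x y := by
  constructor
  · rintro ⟨e, i, hi, hi'⟩
    exact Glue.glue (H := H.relabel g hg) (σ := fun e => (σ e).relabel (h e) (hh e)) e i hi hi'
  · rintro ⟨e, i, hi, hi'⟩
    exact Glue.glue (H := H) (σ := σ) e i hi hi'

/-- Gluing sees only attachments and external nodes, never labels. The new labels may vary from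
hyperedge to hyperedge, because annotations are not a function of the old labels. -/
theorem replace_relabel_isomorphic (H : LabelledHypergraph C) (σ : H.E → LabelledHypergraph C)
    (g : H.E → D.Label) (hg) (h : ∀ e, (σ e).E → D.Label)
    (hh : ∀ e x, D.type (h e x) = ((σ e).att x).length) (hs) :
    ((H.replace σ).relabel (fun x : Σ e, (σ e).E => h x.1 x.2) hs).Isomorphic
      ((H.relabel g hg).replace fun e => (σ e).relabel (h e) (hh e)) := by
  let q := Quot.congr (Equiv.refl _) (glue_relabel_iff H σ g hg h hh)
  refine ⟨q, Equiv.refl _,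
    fun e => ?_, fun e => rfl, ?_⟩
  · exact (List.map_map (l := (σ e.1).att e.2)
      (f := fun v => Quot.mk (Glue H σ) (Sum.inr ⟨e.1, v⟩)) (g := q)).symm
  · exact (List.map_map (l := H.ext) (f := fun v => Quot.mk (Glue H σ) (Sum.inl v)) (g := q)).symm

theorem mapLabel_replace_isomorphic (H : LabelledHypergraph C) (σ : H.E → LabelledHypergraph C)
    (φ : C.Label → D.Label) (hφ : ∀ X, D.type (φ X) = C.type X) :
    ((H.replace σ).mapLabel φ hφ).Isomorphic
      ((H.mapLabel φ hφ).replace fun e => (σ e).mapLabel φ hφ) :=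
  replace_relabel_isomorphic H σ _ _ (fun e x => φ ((σ e).lab x)) _ _

theorem glue_inl_inr_iff {H : LabelledHypergraph C} {σ : H.E → LabelledHypergraph C} {v : H.V}
    {e : H.E} {u : (σ e).V} : Glue H σ (Sum.inl v) (Sum.inr ⟨e, u⟩) ↔
      ∃ i : ℕ, (H.att e)[i]? = some v ∧ (σ e).ext[i]? = some u := by
  constructor
  · rintro ⟨_, i, hi, hi'⟩
    exact ⟨i, List.getElem?_eq_getElem hi, List.getElem?_eq_getElem hi'⟩
  · rintro ⟨i, h, h'⟩
    obtain ⟨hi, rfl⟩ := List.getElem?_eq_some_iff.1 h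
    obtain ⟨hi', rfl⟩ := List.getElem?_eq_some_iff.1 h'
    exact ⟨e, i, hi, hi'⟩

theorem replace_comp_isomorphic {H H₁ : LabelledHypergraph C} (fV : H.V ≃ H₁.V) (fE : H.E ≃ H₁.E)
    (hatt : ∀ e, H₁.att (fE e) = (H.att e).map fV) (hext : H₁.ext = H.ext.map fV)
    (σ : H₁.E → LabelledHypergraph C) :
    (H.replace (σ ∘ fE)).Isomorphic (H₁.replace σ) := by
  let p : (H.V ⊕ Σ e, (σ (fE e)).V) ≃ (H₁.V ⊕ Σ e, (σ e).V) :=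
    Equiv.sumCongr fV (Equiv.sigmaCongrLeft (β := fun e => (σ e).V) fE)
  have hp : ∀ x y, Glue H (σ ∘ fE) x y ↔ Glue H₁ σ (p x) (p y) := by
    rintro (v | ⟨e, v⟩) (v' | ⟨e', v'⟩)
    · have hinl : ∀ a b, ¬ Glue H₁ σ (Sum.inl a) (Sum.inl b) := fun _ _ h => nomatch h
      exact ⟨(fun h => nomatch h), fun h => (hinl _ _ h).elim⟩
    · refine glue_inl_inr_iff.trans (Iff.trans ?_ glue_inl_inr_iff.symm)
      simp [hatt]
    · exact ⟨(fun h => nomatch h),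
        fun h : Glue H₁ σ (Sum.inr ⟨fE e, v⟩) (Sum.inl (fV v')) => nomatch h⟩
    · exact ⟨(fun h => nomatch h),
        fun h : Glue H₁ σ (Sum.inr ⟨fE e, v⟩) (Sum.inr ⟨fE e', v'⟩) => nomatch h⟩
  let q := Quot.congr p hp
  refine ⟨q, Equiv.sigmaCongrLeft (β := fun e => (σ e).E) fE, fun e => ?_, fun e => rfl, ?_⟩
  · exact (List.map_map (l := (σ (fE e.1)).att e.2)
      (f := fun v => Quot.mk (Glue H (σ ∘ fE)) (Sum.inr ⟨e.1, v⟩)) (g := q)).symm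
  · refine Eq.trans ?_ (List.map_map (l := H.ext)
      (f := fun v => Quot.mk (Glue H (σ ∘ fE)) (Sum.inl v)) (g := q)).symm
    simp only [replace, hext, List.map_map]
    rfl

/-- Since the types agree, every node of the handle is glued to an external node of `R`; hence every
class has a representative in `R`, which the retraction `r` computes. -/
theorem handle_replace_isomorphic (X : C.Label) (R : LabelledHypergraph C)
    (hR : C.type X = R.type) : R.Isomorphic ((handle X).replace fun _ => R) := by
  have hlen : (handle X).ext.length = R.ext.length := by simpa [handle, type] using hR
  let r : (handle X).V ⊕ (Σ _ : (handle X).E, R.V) → R.V :=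
    Sum.elim (fun i : Fin (C.type X) => R.ext[i.1]'(i.2.trans_eq hR)) fun p => p.2
  have hr : ∀ x y, Glue (handle X) (fun _ => R) x y → r x = r y := by
    rintro _ _ ⟨e, i, hi, hi'⟩
    simp only [handle, List.getElem_finRange, Sum.elim_inl, Sum.elim_inr, r]
    rfl
  have key : ∀ x, Quot.mk (Glue (handle X) fun _ => R) (Sum.inr ⟨(), r x⟩) = Quot.mk _ x := by
    rintro (i | ⟨⟨⟩, v⟩)
    · have := Quot.sound (Glue.glue (H := handle X) (σ := fun _ => R) () i.1
        (by simpa only [handle, List.length_finRange] using i.2) (i.2.trans_eq hR))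
      have h' : ((handle X).att ())[i.1]'(by simpa only [handle, List.length_finRange] using i.2)
          = i := by
        simp only [handle, List.getElem_finRange]
        rfl
      rw [h'] at this
      exact this.symm
    · rfl
  refine ⟨⟨fun v => Quot.mk _ (Sum.inr ⟨(), v⟩), Quot.lift r hr, fun v => rfl,
    fun x => ?_⟩, ⟨fun e => ⟨(), e⟩, fun x => x.2, fun e => rfl, fun x => rfl⟩,
    fun e => rfl, fun e => rfl, ?_⟩
  · induction x using Quot.ind with | mk x => exact key x
  · apply List.ext_getElem
    · simpa [replace] using hlen
    · intro i h1 h2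
      have hi : i < C.type X := by simpa [replace, handle] using h1
      have := key (Sum.inl (⟨i, hi⟩ : Fin (C.type X)))
      refine (List.getElem_map (l := (handle X).ext) _).trans ?_
      refine Eq.trans ?_ (List.getElem_map (l := R.ext) _).symm
      have h' : (handle X).ext[i]'(by simpa [handle] using hi) = (⟨i, hi⟩ : Fin (C.type X)) := by
        simp only [handle, List.getElem_finRange]
        rfl
      rw [h']
      exact this.symm

theorem Represents.mapLabel {H : LabelledHypergraph C} {w : List C.Label} (h : H.Represents w)
    (φ : C.Label → D.Label) (hφ : ∀ X, D.type (φ X) = C.type X) :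
    (H.mapLabel φ hφ).Represents (w.map φ) := by
  obtain ⟨hw, h⟩ := h
  have hw' : ∀ x ∈ w.map φ, D.type x = 2 := by
    intro x hx
    obtain ⟨y, hy, rfl⟩ := List.mem_map.1 hx
    rw [hφ, hw y hy]
  refine ⟨hw', (h.mapLabel φ hφ).trans ?_⟩
  refine ⟨finCongr (by simp), finCongr (by simp), fun e => ?_, fun e => ?_, ?_⟩
  · rfl
  · change (w.map φ).get _ = φ (w.get e)
    exact List.getElem_map (l := w) φ
  · change [_, _] = [_, _]
    congr 1
    congr 1
    exact Fin.ext (a := Fin.last (w.map φ).length)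
      (b := finCongr (by simp) (Fin.last w.length)) (List.length_map φ)

end LabelledHypergraph

/-! ### Automaton runs as state assignments on string graphs. -/

/-- `p` is connected to `r` by a path labelled by the given word in the transition relation `δ`. -/
def LabelledPath {X Q : Type*} (δ : Q → X → Q → Prop) : Q → List X → Q → Prop
  | p, [], r => p = r
  | p, a :: w, r => ∃ s, δ p a s ∧ LabelledPath δ s w r

theorem labelledPath_iff_exists_states {X Q : Type*} (δ : Q → X → Q → Prop) (p : Q) (w : List X)
    (r : Q) : LabelledPath δ p w r ↔ ∃ g : Fin (w.length + 1) → Q, g 0 = p ∧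
      g (Fin.last _) = r ∧ ∀ i : Fin w.length, δ (g i.castSucc) (w.get i) (g i.succ) := by
  induction w generalizing p with
  | nil =>
    constructor
    · rintro rfl
      exact ⟨fun _ => p, rfl, rfl, fun i => i.elim0⟩
    · rintro ⟨g, rfl, rfl, -⟩
      rfl
  | cons a w ih =>
    constructor
    · rintro ⟨s, hs, h⟩
      obtain ⟨g, rfl, rfl, hg⟩ := (ih s).1 h
      refine ⟨Fin.cons p g, rfl, rfl, fun i => ?_⟩
      refine Fin.cases ?_ (fun i => ?_) i
      · exact hs
      · exact hg i
    · rintro ⟨g, rfl, rfl, hg⟩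
      exact ⟨g 1, hg 0, (ih _).2 ⟨fun i => g i.succ, rfl, rfl, fun i => hg i.succ⟩⟩

theorem labelledPath_map {X Y Q : Type*} (δ : Q → Y → Q → Prop) (φ : X → Y) (p : Q) (w : List X)
    (r : Q) : LabelledPath δ p (w.map φ) r ↔ LabelledPath (fun p a r => δ p (φ a) r) p w r := by
  induction w generalizing p with
  | nil => rfl
  | cons a w ih => simp [LabelledPath, ih]

/-- Reading through `φ` may make the automaton partial or nondeterministic; a path simply chooses a
preimage letter at each step. -/
theorem DFA.labelledPath_iff {α X Q : Type*} (M : DFA X Q) (φ : X → α) (p : Q) (w : List α)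
    (r : Q) : LabelledPath (fun p a r => ∃ x, φ x = a ∧ M.step p x = r) p w r ↔
      ∃ u : List X, u.map φ = w ∧ M.evalFrom p u = r := by
  induction w generalizing p with
  | nil => simp [LabelledPath]
  | cons a w ih =>
    simp only [LabelledPath, ih]
    constructor
    · rintro ⟨_, ⟨x, rfl, rfl⟩, u, rfl, rfl⟩
      exact ⟨x :: u, rfl, rfl⟩
    · rintro ⟨_ | ⟨x, u⟩, h, rfl⟩
      · simp at h
      · simp only [List.map_cons, List.cons.injEq] at h
        exact ⟨_, ⟨x, h.1, rfl⟩, u, h.2, rfl⟩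

/-- The nodes of a string graph are the positions between letters, so a run is a state for each node
with a local condition at each hyperedge. -/
theorem LabelledHypergraph.Represents.labelledPath_iff {C : Signature} {Q : Type*}
    {H : LabelledHypergraph C} {w : List C.Label} (h : H.Represents w)
    (δ : Q → C.Label → Q → Prop) (p r : Q) :
    LabelledPath δ p w r ↔ ∃ f : H.V → Q, H.ext.map f = [p, r] ∧
      ∀ e, ∃ a b, (H.att e).map f = [a, b] ∧ δ a (H.lab e) b := by
  rw [labelledPath_iff_exists_states]
  obtain ⟨hw, h⟩ := h
  constructor
  · rintro ⟨g, rfl, rfl, hg⟩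
    obtain ⟨fV, fE, h1, h2, h3⟩ := h
    refine ⟨g ∘ fV, ?_, fun e => ⟨_, _, ?_, Eq.mp (congrArg (δ _ · _) (h2 e)) (hg (fE e))⟩⟩
    · exact (List.map_map (l := H.ext) (f := fV) (g := g)).symm.trans
        (congrArg (List.map g) h3).symm
    · exact (List.map_map (l := H.att e) (f := fV) (g := g)).symm.trans
        (congrArg (List.map g) (h1 e)).symm
  · rintro ⟨f, hf, hd⟩
    obtain ⟨fV, fE, h1, h2, h3⟩ := h.symm
    rw [h3, List.map_map] at hf
    simp only [stringGraph, List.map_cons, List.map_nil, List.cons.injEq, and_true] at hf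
    refine ⟨f ∘ fV, hf.1, hf.2, fun i => ?_⟩
    obtain ⟨a, b, hab, hδ⟩ := hd (fE i)
    replace hab := (congrArg (List.map f) (h1 i)).symm.trans hab
    rw [List.map_map] at hab
    simp only [stringGraph, List.map_cons, List.map_nil, List.cons.injEq, and_true] at hab
    obtain ⟨rfl, rfl⟩ := hab
    exact Eq.mp (congrArg (δ _ · _) (h2 i)) hδ

/-! ### Annotated labels, hypergraphs and tables. -/

/-- The labels of the intersection grammar: labels annotated with one automaton state per
attachment node, copies of the labels themselves, labels that are never eliminated, and initial
labels. -/
inductive AnnotatedLabel (C : Signature) (Q : Type)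
  | state (X : C.Label) (q : List.Vector Q (C.type X))
  | plain (X : C.Label)
  | dead (X : C.Label)
  | start (X : C.Label)

namespace AnnotatedLabel

variable {C : Signature} {Q : Type}

/-- The label of which the given one is an annotated version. -/
def forget : AnnotatedLabel C Q → C.Label
  | state X _ => X
  | plain X => X
  | dead X => X
  | start X => X

instance [Finite Q] : Finite (AnnotatedLabel C Q) := by
  let F : (Σ X, List.Vector Q (C.type X)) ⊕ C.Label ⊕ C.Label ⊕ C.Label → AnnotatedLabel C Q :=
    Sum.elim (fun p => state p.1 p.2) (Sum.elim plain (Sum.elim dead start))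
  refine Finite.of_surjective F ?_
  rintro (⟨X, q⟩ | X | X | X)
  exacts [⟨.inl ⟨X, q⟩, rfl⟩, ⟨.inr (.inl X), rfl⟩, ⟨.inr (.inr (.inl X)), rfl⟩,
    ⟨.inr (.inr (.inr X)), rfl⟩]

/-- The label agrees with the given sequence of states at the attachment nodes: an annotated label
carries these states, and a terminal label admits a transition between them. -/
def Fits (δ : Q → C.Label → Q → Prop) (P : Set C.Label) : AnnotatedLabel C Q → List Q → Prop
  | state _ q, qs => q.toList = qs
  | plain X, qs => X ∈ P ∧ ∃ a b, qs = [a, b] ∧ δ a X b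
  -- Dead and start labels fit nowhere, so an annotated right-hand side contains neither.
  | dead _, _ => False
  | start _, _ => False

end AnnotatedLabel

/-- The signature of all annotated labels. -/
abbrev annotatedSignature (C : Signature) (Q : Type) [Finite Q] : Signature where
  Label := AnnotatedLabel C Q
  type l := C.type l.forget

namespace LabelledHypergraph

variable {C : Signature} {Q : Type} [Finite Q]

/-- Removal of all annotations. -/
abbrev forget (H : LabelledHypergraph (annotatedSignature C Q)) : LabelledHypergraph C :=
  H.mapLabel AnnotatedLabel.forget fun _ => rfl

/-- Forgetting keeps nodes and hyperedges literally, so only the finitely many labellings vary. For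
this reason `Table.annotated` compares right-hand sides by equality and not up to isomorphism. -/
theorem finite_forget_fiber (R : LabelledHypergraph C) :
    {H : LabelledHypergraph (annotatedSignature C Q) | H.forget = R}.Finite := by
  refine (Set.finite_range fun g : {g : R.E → AnnotatedLabel C Q // ∀ e, (g e).forget = R.lab e} =>
    R.relabel (D := annotatedSignature C Q) g.1
      fun e => (congrArg C.type (g.2 e)).trans (R.type_lab e)).subset ?_
  rintro H rfl
  exact ⟨⟨H.lab, fun e => rfl⟩, rfl⟩

/-- The assignment `f` of states to nodes fits all labels. -/
def Annotates (δ : Q → C.Label → Q → Prop) (P : Set C.Label)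
    (H : LabelledHypergraph (annotatedSignature C Q)) (f : H.V → Q) : Prop :=
  ∀ e, AnnotatedLabel.Fits δ P (H.lab e) ((H.att e).map f)

/-- `H` has a hyperedge that is never eliminated. -/
def HasDead (H : LabelledHypergraph (annotatedSignature C Q)) : Prop :=
  ∃ e X, H.lab e = AnnotatedLabel.dead X

theorem Isomorphic.hasDead {H H' : LabelledHypergraph (annotatedSignature C Q)}
    (h : H.Isomorphic H') (hH : H.HasDead) : H'.HasDead := by
  obtain ⟨fV, fE, h1, h2, h3⟩ := h
  obtain ⟨e, X, he⟩ := hH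
  exact ⟨fE e, X, (h2 e).trans he⟩

theorem Isomorphic.exists_annotates {H H' : LabelledHypergraph (annotatedSignature C Q)}
    (h : H.Isomorphic H') {δ : Q → C.Label → Q → Prop} {P : Set C.Label} {f : H.V → Q}
    (hf : H.Annotates δ P f) :
    ∃ f' : H'.V → Q, H'.Annotates δ P f' ∧ H'.ext.map f' = H.ext.map f := by
  obtain ⟨fV, fE, h1, h2, h3⟩ := h
  refine ⟨f ∘ fV.symm, fun e => ?_, by simp [h3]⟩
  obtain ⟨e, rfl⟩ := fE.surjective e
  rw [h1, h2, List.map_map]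
  rw [Function.comp_assoc, Equiv.symm_comp_self, Function.comp_id]
  exact hf e

/-- By `hext` glued nodes carry equal states, so the assignments descend to the quotient. -/
theorem exists_annotates_replace {H : LabelledHypergraph (annotatedSignature C Q)}
    {σ : H.E → LabelledHypergraph (annotatedSignature C Q)} {δ : Q → C.Label → Q → Prop}
    {P : Set C.Label} (f : H.V → Q) (F : ∀ e, (σ e).V → Q)
    (hF : ∀ e, (σ e).Annotates δ P (F e)) (hext : ∀ e, (σ e).ext.map (F e) = (H.att e).map f) :
    ∃ f' : (H.replace σ).V → Q, (H.replace σ).Annotates δ P f' ∧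
      (H.replace σ).ext.map f' = H.ext.map f := by
  refine ⟨Quot.lift (Sum.elim f fun p => F p.1 p.2) ?_, fun e => ?_, ?_⟩
  · rintro _ _ ⟨e, i, hi, hi'⟩
    have := List.getElem_of_eq (hext e) (i := i) (by simpa using hi')
    simpa using this.symm
  · have := hF e.1 e.2
    simp only [replace, List.map_map]
    exact this
  · simp only [replace, List.map_map]
    rfl

theorem hasDead_replace {H : LabelledHypergraph (annotatedSignature C Q)}
    {σ : H.E → LabelledHypergraph (annotatedSignature C Q)} {e : H.E} (h : (σ e).HasDead) :
    (H.replace σ).HasDead := by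
  obtain ⟨x, X, hx⟩ := h
  exact ⟨⟨e, x⟩, X, hx⟩

end LabelledHypergraph

open LabelledHypergraph

namespace Table

variable {C : Signature} {Q : Type} [Finite Q]

/-- The table of all annotated versions of the rules of `T`. An annotated label may be replaced by
a right-hand side with fitting states, an initial label `X` by the annotated handles of `X` with
admissible states at the external nodes, and every label by a handle that is never eliminated. -/
def annotated (T : Table C) (δ : Q → C.Label → Q → Prop) (P : Set C.Label) (I : Set (List Q)) :
    Table (annotatedSignature C Q) where
  rules := {r |
    (∃ X q, r.1 = .state X q ∧ (X, r.2.forget) ∈ T.rules ∧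
      ∃ f, r.2.Annotates δ P f ∧ r.2.ext.map f = q.toList) ∨
    (∃ X, r.1 = .start X ∧ r.2.forget = handle X ∧
      ∃ f, r.2.Annotates δ P f ∧ r.2.ext.map f ∈ I) ∨
    -- This makes the table total. It is the only alternative for plain labels, which therefore
    -- survive only in the last step, and for dead labels, which therefore never disappear.
    r.2 = handle (C := annotatedSignature C Q) (.dead r.1.forget)}
  finite_rules := by
    have h1 : (forget (Q := Q) ⁻¹' (Prod.snd '' T.rules ∪ Set.range handle)).Finite :=
      Set.Finite.preimage' ((T.finite_rules.image _).union (Set.finite_range _))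
        fun R _ => finite_forget_fiber R
    refine ((Set.finite_univ (α := AnnotatedLabel C Q)).prod
      (h1.union (Set.finite_range handle))).subset ?_
    rintro ⟨l, R⟩ (⟨X, q, -, h, -⟩ | ⟨X, -, h, -⟩ | h)
    · exact ⟨trivial, .inl (.inl ⟨_, h, rfl⟩)⟩
    · exact ⟨trivial, .inl (.inr ⟨_, h.symm⟩)⟩
    · exact ⟨trivial, .inr ⟨_, h.symm⟩⟩
  typed := by
    rintro ⟨l, R⟩ (⟨X, q, rfl, h, -⟩ | ⟨X, rfl, h, -⟩ | h)
    · exact T.typed _ h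
    · have : R.forget.type = (handle X).type := by rw [h]
      refine Eq.trans ?_ this.symm
      simp [LabelledHypergraph.type, handle, AnnotatedLabel.forget]
    · dsimp only at h
      subst h
      simp [LabelledHypergraph.type, handle, AnnotatedLabel.forget]
  total l := ⟨handle (C := annotatedSignature C Q) (.dead l.forget), .inr (.inr rfl)⟩

end Table

/-! ### Derivations up to isomorphism. -/

section Derivations

variable {C : Signature}

theorem ParallelStep.trans_isomorphic {T : Table C} {H H₁ H₂ : LabelledHypergraph C}
    (h : ParallelStep T H H₁) (h' : H₁.Isomorphic H₂) : ParallelStep T H H₂ := by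
  obtain ⟨σ, h1, h2⟩ := h
  exact ⟨σ, h1, h'.symm.trans h2⟩

theorem ParallelDerives.trans_isomorphic {𝒯 : Set (Table C)} {H H₁ H₂ : LabelledHypergraph C}
    (h : ParallelDerives 𝒯 H H₁) (h' : H₁.Isomorphic H₂) : ParallelDerives 𝒯 H H₂ := by
  rcases h with h | h
  · exact .inl (h.trans h')
  · refine .inr ?_
    cases h with
    | single h =>
      obtain ⟨T, hT, h⟩ := h
      exact .single ⟨T, hT, h.trans_isomorphic h'⟩
    | tail h1 h =>
      obtain ⟨T, hT, h⟩ := h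
      exact h1.tail ⟨T, hT, h.trans_isomorphic h'⟩

theorem LabelledHypergraph.Isomorphic.parallelStep {T : Table C} {H H₁ H₂ : LabelledHypergraph C}
    (h : H.Isomorphic H₁) (h' : ParallelStep T H₁ H₂) : ParallelStep T H H₂ := by
  obtain ⟨fV, fE, h1, h2, h3⟩ := h
  obtain ⟨σ, hσ, h'⟩ := h'
  exact ⟨σ ∘ fE, fun e => h2 e ▸ hσ (fE e), h'.trans (replace_comp_isomorphic fV fE h1 h3 σ).symm⟩

theorem ParallelDerives.step {𝒯 : Set (Table C)} {H H₁ H₂ : LabelledHypergraph C} {T : Table C}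
    (h : ParallelDerives 𝒯 H H₁) (hT : T ∈ 𝒯) (h' : ParallelStep T H₁ H₂) :
    ParallelDerives 𝒯 H H₂ := by
  rcases h with h | h
  · exact .inr (.single ⟨T, hT, h.parallelStep h'⟩)
  · exact .inr (h.tail ⟨T, hT, h'⟩)

end Derivations

/-! ### Projecting and lifting single steps. -/

namespace Table

variable {C : Signature} {Q : Type} [Finite Q] {T : Table C} {δ : Q → C.Label → Q → Prop}
  {P : Set C.Label} {I : Set (List Q)}

theorem hasDead_of_parallelStep_annotated {H H' : LabelledHypergraph (annotatedSignature C Q)}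
    (hH : H.HasDead) (h : ParallelStep (T.annotated δ P I) H H') : H'.HasDead := by
  obtain ⟨σ, hσ, h⟩ := h
  obtain ⟨e, X, he⟩ := hH
  refine h.symm.hasDead (hasDead_replace (e := e) ?_)
  rcases hσ e with ⟨Y, q, hY, -⟩ | ⟨Y, hY, -⟩ | hd
  · rw [he] at hY
    cases hY
  · rw [he] at hY
    cases hY
  · dsimp only at hd
    rw [hd]
    exact ⟨(), _, rfl⟩

/-- Unless a dead handle is inserted, every hyperedge uses an annotated rule of `T`, so all its
labels are of the `state` kind. The states in these labels make the assignments on the right-hand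
sides agree with `f`. -/
theorem hasDead_or_of_parallelStep_annotated
    {H H' : LabelledHypergraph (annotatedSignature C Q)} {f : H.V → Q} (hf : H.Annotates δ P f)
    (h : ParallelStep (T.annotated δ P I) H H') :
    H'.HasDead ∨ (ParallelStep T H.forget H'.forget ∧
      ∃ f' : H'.V → Q, H'.Annotates δ P f' ∧ H'.ext.map f' = H.ext.map f) := by
  obtain ⟨σ, hσ, h⟩ := h
  by_cases hd : ∃ e, (σ e).HasDead
  · obtain ⟨e, he⟩ := hd
    exact .inl (h.symm.hasDead (hasDead_replace he))
  push Not at hd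
  have key : ∀ e, ((H.lab e).forget, (σ e).forget) ∈ T.rules ∧
      ∃ F, (σ e).Annotates δ P F ∧ (σ e).ext.map F = (H.att e).map f := by
    intro e
    have hfe := hf e
    rcases hσ e with ⟨X, q, hX, hr, F, hF, hq⟩ | ⟨X, hX, -⟩ | h
    · dsimp only at hX hr F hF hq
      rw [hX] at hfe
      refine ⟨?_, F, hF, hq.trans hfe⟩
      rw [hX]
      exact hr
    · dsimp only at hX
      rw [hX] at hfe
      exact hfe.elim
    · refine absurd ?_ (hd e)
      dsimp only at h
      rw [h]
      exact ⟨(), _, rfl⟩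
  choose hr F hF hext using key
  obtain ⟨f', hf', hext'⟩ := exists_annotates_replace f F hF hext
  obtain ⟨f'', hf'', hext''⟩ := h.symm.exists_annotates hf'
  refine .inr ⟨⟨fun e => (σ e).forget, hr, ?_⟩, f'', hf'', hext''.trans hext'⟩
  exact (h.mapLabel _ _).trans (mapLabel_replace_isomorphic H σ _ _)

theorem hasDead_or_of_parallelStep_annotated_start {X : C.Label}
    {H' : LabelledHypergraph (annotatedSignature C Q)}
    (h : ParallelStep (T.annotated δ P I) (handle (C := annotatedSignature C Q) (.start X)) H') :
    H'.HasDead ∨ ((handle X).Isomorphic H'.forget ∧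
      ∃ f' : H'.V → Q, H'.Annotates δ P f' ∧ H'.ext.map f' ∈ I) := by
  obtain ⟨σ, hσ, h⟩ := h
  have hiso : (σ ()).Isomorphic H' :=
    (handle_replace_isomorphic _ _ ((T.annotated δ P I).typed _ (hσ ()))).trans h.symm
  rcases hσ () with ⟨Y, q, hY, -⟩ | ⟨Y, hY, hr, f, hf, hI⟩ | hd
  · cases hY
  · cases hY
    dsimp only at hr f hf hI
    obtain ⟨f', hf', hext⟩ := hiso.exists_annotates hf
    exact .inr ⟨hr ▸ hiso.mapLabel _ _, f', hf', hext ▸ hI⟩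
  · dsimp only at hd
    rw [hd] at hiso
    exact .inl (hiso.hasDead ⟨(), _, rfl⟩)

theorem parallelStep_annotated_start {X : C.Label}
    {H' : LabelledHypergraph (annotatedSignature C Q)} (h : (handle X).Isomorphic H'.forget)
    {f : H'.V → Q} (hf : H'.Annotates δ P f) (hI : H'.ext.map f ∈ I) :
    ParallelStep (T.annotated δ P I) (handle (C := annotatedSignature C Q) (.start X)) H' := by
  obtain ⟨R, hR, hiso⟩ := exists_lift_of_isomorphic_mapLabel _ _ h
  obtain ⟨f', hf', hext⟩ := hiso.symm.exists_annotates hf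
  have hr : (.start X, R) ∈ (T.annotated δ P I).rules :=
    .inr (.inl ⟨X, rfl, hR, f', hf', hext ▸ hI⟩)
  exact ⟨fun _ => R, fun _ => hr,
    hiso.symm.trans (handle_replace_isomorphic _ _ ((T.annotated δ P I).typed _ hr))⟩

/-- Steps lift backwards: the assignment on the result determines one on the source, whereas a
forward lift would have to guess the states of new nodes. The node maps into the quotient need not
be injective, so repeated external nodes cause no trouble. -/
theorem exists_parallelStep_annotated {H : LabelledHypergraph C}
    {H' : LabelledHypergraph (annotatedSignature C Q)} (h : ParallelStep T H H'.forget)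
    {f : H'.V → Q} (hf : H'.Annotates δ P f) :
    ∃ H₁ : LabelledHypergraph (annotatedSignature C Q), H₁.forget = H ∧
      (∃ f₁, H₁.Annotates δ P f₁ ∧ H₁.ext.map f₁ = H'.ext.map f) ∧
      ParallelStep (T.annotated δ P I) H₁ H' := by
  obtain ⟨σ, hσ, h⟩ := h
  obtain ⟨fV, fE, h1, h2, h3⟩ := h.symm
  -- Restrictions of `f` to the old nodes and to each inserted right-hand side; they agree along the
  -- gluing by `Quot.sound`.
  let f₁ : H.V → Q := fun v => f (fV (Quot.mk _ (Sum.inl v)))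
  let F : ∀ e, (σ e).V → Q := fun e v => f (fV (Quot.mk _ (Sum.inr ⟨e, v⟩)))
  have hlab : ∀ e x, (H'.lab (fE ⟨e, x⟩)).forget = (σ e).lab x := fun e x => h2 ⟨e, x⟩
  have hlab' : ∀ e x, C.type (H'.lab (fE ⟨e, x⟩)).forget = ((σ e).att x).length := fun e x =>
    (congrArg C.type (hlab e x)).trans ((σ e).type_lab x)
  have hatt : ∀ e x, (H'.att (fE ⟨e, x⟩)).map f = ((σ e).att x).map (F e) := by
    intro e x
    let m : (σ e).V → (H.replace σ).V := fun v => Quot.mk _ (Sum.inr ⟨e, v⟩)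
    exact (congrArg (List.map f) ((h1 ⟨e, x⟩).trans (List.map_map (f := m) (g := fV)))).trans
      (List.map_map (f := fV ∘ m) (g := f))
  have hext : H'.ext.map f = H.ext.map f₁ := by
    let m : H.V → (H.replace σ).V := fun v => Quot.mk _ (Sum.inl v)
    exact (congrArg (List.map f) (h3.trans (List.map_map (f := m) (g := fV)))).trans
      (List.map_map (f := fV ∘ m) (g := f))
  have hglue : ∀ e, (σ e).ext.map (F e) = (H.att e).map f₁ := by
    intro e
    have hlen : (H.att e).length = (σ e).ext.length :=
      (H.type_lab e).symm.trans (T.typed _ (hσ e))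
    refine List.ext_getElem (by simp [hlen]) fun i hi hi' => ?_
    rw [List.length_map] at hi hi'
    rw [List.getElem_map, List.getElem_map]
    exact congrArg (fun v => f (fV v)) (Quot.sound (Glue.glue e i hi' hi)).symm
  -- The source receives `state` labels only, even on terminals, so plain labels are confined to the
  -- end of the lifted derivation.
  refine ⟨H.relabel (D := annotatedSignature C Q)
    (fun e => .state (H.lab e) ⟨(H.att e).map f₁, by simp [H.type_lab]⟩) H.type_lab, rfl,
    ⟨f₁, fun e => rfl, hext.symm⟩, fun e => (σ e).relabel (D := annotatedSignature C Q)
      (fun x => H'.lab (fE ⟨e, x⟩)) (hlab' e), fun e => ?_, ?_⟩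
  · refine .inl ⟨H.lab e, _, rfl, ?_, F e, fun x => ?_, hglue e⟩
    · exact Eq.mpr (congrArg (fun R => (H.lab e, R) ∈ T.rules)
        (mapLabel_relabel (D := annotatedSignature C Q) (σ e) _ (fun _ => rfl) _ (hlab' e)
          (hlab e))) (hσ e)
    · exact Eq.mp (congrArg (AnnotatedLabel.Fits δ P _) (hatt e x)) (hf (fE ⟨e, x⟩))
  · refine Isomorphic.trans (Isomorphic.symm ?_)
      (replace_relabel_isomorphic (D := annotatedSignature C Q) H σ _ _
        (fun e x => H'.lab (fE ⟨e, x⟩)) hlab'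
        fun x => (hlab' x.1 x.2).trans (List.length_map ..).symm)
    exact relabel_isomorphic (H := H') fV fE h1 h3 _

end Table

/-! ### The annotated grammar and its hypergraph language. -/

namespace PHRGrammar

variable (G : PHRGrammar) {Q : Type} [Finite Q] (δ : Q → G.sig.Label → Q → Prop)
  (I : Set (List Q))

/-- The grammar that generates the members of the language of `G` whose nodes can be annotated by
states, following the transitions `δ` along the hyperedges, such that the sequence of the states of
the external nodes belongs to `I`. -/
def annotated : PHRGrammar where
  sig := annotatedSignature G.sig Q
  terminals := AnnotatedLabel.plain '' G.terminals
  start := .start G.start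
  tables := (fun T : Table G.sig => T.annotated δ G.terminals I) '' G.tables
  finite_tables := G.finite_tables.image _
  nonempty_tables := G.nonempty_tables.image _

variable {G δ I}

theorem IsOfOrder.annotated {k l : ℕ} (h : G.IsOfOrder k l) :
    (G.annotated δ I).IsOfOrder k l := by
  refine ⟨?_, (Set.ncard_image_le G.finite_tables).trans h.2⟩
  rintro _ ⟨T, hT, rfl⟩ r hr
  refine ((T.annotated δ G.terminals I).typed r hr).ge.trans ?_
  -- The added rules are bounded as well: totality of `T` gives an old rule of the same type.
  obtain ⟨R, hR⟩ := T.total r.1.forget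
  exact (T.typed _ hR).trans_le (h.1 T hT _ hR)

theorem repetitionFree_handle {C : Signature} (X : C.Label) : (handle X).RepetitionFree :=
  List.nodup_finRange _

theorem RepetitionFree.annotated (h : G.RepetitionFree) : (G.annotated δ I).RepetitionFree := by
  rintro _ ⟨T, hT, rfl⟩ ⟨l, R⟩ (⟨X, q, -, hr, -⟩ | ⟨X, -, hr, -⟩ | hr)
  · exact h T hT _ hr
  · have := repetitionFree_handle X
    rw [← hr] at this
    exact this
  · dsimp only at hr
    rw [hr]
    exact repetitionFree_handle _

theorem hasDead_or_of_parallelDerives_annotated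
    {H : LabelledHypergraph (annotatedSignature G.sig Q)}
    (h : Relation.TransGen (fun H H' => ∃ T ∈ (G.annotated δ I).tables, ParallelStep T H H')
      (handle (G.annotated δ I).start) H) :
    H.HasDead ∨ (ParallelDerives G.tables (handle G.start) H.forget ∧
      ∃ f : H.V → Q, H.Annotates δ G.terminals f ∧ H.ext.map f ∈ I) := by
  induction h with
  | single h =>
    obtain ⟨_, ⟨T, hT, rfl⟩, h⟩ := h
    rcases Table.hasDead_or_of_parallelStep_annotated_start h with h | ⟨h, h'⟩
    · exact .inl h
    · exact .inr ⟨.inl h, h'⟩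
  | tail _ h ih =>
    obtain ⟨_, ⟨T, hT, rfl⟩, h⟩ := h
    rcases ih with ih | ⟨hd, f, hf, hI⟩
    · exact .inl (Table.hasDead_of_parallelStep_annotated ih h)
    · rcases Table.hasDead_or_of_parallelStep_annotated hf h with h | ⟨h, f', hf', hext⟩
      · exact .inl h
      · exact .inr ⟨hd.step hT h, f', hf', hext ▸ hI⟩

/-- The assignment travels back from `H` to the handle of the old start symbol. One further step,
available in any table, leads there from the new start label. -/
theorem parallelDerives_annotated {H : LabelledHypergraph (annotatedSignature G.sig Q)}
    (h : ParallelDerives G.tables (handle G.start) H.forget) {f : H.V → Q}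
    (hf : H.Annotates δ G.terminals f) (hI : H.ext.map f ∈ I) :
    Relation.TransGen (fun H H' => ∃ T ∈ (G.annotated δ I).tables, ParallelStep T H H')
      (handle (G.annotated δ I).start) H := by
  have base : ∀ {H : LabelledHypergraph (annotatedSignature G.sig Q)} {f : H.V → Q},
      (handle G.start).Isomorphic H.forget → H.Annotates δ G.terminals f → H.ext.map f ∈ I →
      Relation.TransGen (fun H H' => ∃ T ∈ (G.annotated δ I).tables, ParallelStep T H H')
        (handle (G.annotated δ I).start) H := by
    intro H f h hf hI
    obtain ⟨T, hT⟩ := G.nonempty_tables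
    exact .single ⟨_, ⟨T, hT, rfl⟩, Table.parallelStep_annotated_start h hf hI⟩
  rcases h with h | h
  · exact base h hf hI
  · generalize hK : H.forget = K at h
    induction h generalizing H with
    | single h =>
      obtain ⟨T, hT, h⟩ := h
      subst hK
      obtain ⟨H₁, h₁, ⟨f₁, hf₁, hext⟩, hs⟩ := Table.exists_parallelStep_annotated (I := I) h hf
      exact (base (h₁ ▸ Isomorphic.refl _) hf₁ (hext ▸ hI)).tail ⟨_, ⟨T, hT, rfl⟩, hs⟩
    | tail _ h ih =>
      obtain ⟨T, hT, h⟩ := h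
      subst hK
      obtain ⟨H₁, h₁, ⟨f₁, hf₁, hext⟩, hs⟩ := Table.exists_parallelStep_annotated (I := I) h hf
      exact (ih hf₁ (hext ▸ hI) h₁).tail ⟨_, ⟨T, hT, rfl⟩, hs⟩

theorem mem_language_annotated_iff {H : LabelledHypergraph (annotatedSignature G.sig Q)} :
    H ∈ (G.annotated δ I).language ↔ H.forget ∈ G.language ∧
      (∀ e, H.lab e = .plain (H.lab e).forget) ∧ ∃ f : H.V → Q, H.ext.map f ∈ I ∧
        ∀ e, ∃ a b, (H.att e).map f = [a, b] ∧ δ a (H.lab e).forget b := by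
  constructor
  · rintro ⟨hd, ht⟩
    have hd' : Relation.TransGen (fun H H' => ∃ T ∈ (G.annotated δ I).tables, ParallelStep T H H')
        (handle (G.annotated δ I).start) H := by
      rcases hd with ⟨fV, fE, -, h, -⟩ | h
      -- A derivation without steps ends in a `start` label, which is not terminal.
      · obtain ⟨X, -, hX⟩ := ht (fE ())
        cases hX.trans (h ())
      · exact h
    rcases hasDead_or_of_parallelDerives_annotated hd' with ⟨e, X, he⟩ | ⟨hD, f, hf, hI⟩
    · obtain ⟨Y, -, hY⟩ := ht e
      cases hY.trans he
    · refine ⟨⟨hD, fun e => ?_⟩, fun e => ?_, f, hI, fun e => ?_⟩ <;>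
        obtain ⟨X, hX, he⟩ := ht e
      · change (H.lab e).forget ∈ _
        rw [← he]
        exact hX
      · rw [← he]
        rfl
      · have := hf e
        rw [← he] at this ⊢
        exact this.2
  · rintro ⟨⟨hd, ht⟩, hp, f, hI, hf⟩
    refine ⟨.inr (parallelDerives_annotated hd (f := f) (fun e => ?_) hI),
      fun e => ⟨_, ht e, (hp e).symm⟩⟩
    rw [hp e]
    exact ⟨ht e, hf e⟩

end PHRGrammar

/-! ### From hypergraphs to strings. -/

namespace PHRGrammar

/-- The transitions of `M` on the symbols that are named by the terminals of a grammar. -/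
def terminalStep (G : PHRGrammar) {α B Q : Type*} (name : G.terminals → α) (φ : B → α)
    (M : DFA B Q) (p : Q) (X : G.sig.Label) (r : Q) : Prop :=
  ∃ h : X ∈ G.terminals, ∃ b, φ b = name ⟨X, h⟩ ∧ M.step p b = r

theorem labelledPath_terminalStep_iff {G : PHRGrammar} {α B Q : Type*} (name : G.terminals → α) (φ : B → α)
    (M : DFA B Q) (v : List G.terminals) :
    (∃ r ∈ M.accept, LabelledPath (G.terminalStep name φ M) M.start (v.map Subtype.val) r) ↔
      v.map name ∈ Language.map φ M.accepts := by
  have key : ∀ r, LabelledPath (G.terminalStep name φ M) M.start (v.map Subtype.val) r ↔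
      ∃ u : List B, u.map φ = v.map name ∧ M.evalFrom M.start u = r := by
    intro r
    rw [← DFA.labelledPath_iff, labelledPath_map, labelledPath_map]
    simp [terminalStep]
  simp only [key]
  constructor
  · rintro ⟨r, hr, u, hu, rfl⟩
    exact ⟨u, hr, hu⟩
  · rintro ⟨u, hr, hu⟩
    exact ⟨_, hr, u, hu, rfl⟩

variable {G : PHRGrammar} {Q : Type} [Finite Q] {δ : Q → G.sig.Label → Q → Prop} {I : Set (List Q)}

theorem forget_mem_STR_of_mem_STR_annotated {w : List (G.annotated δ I).sig.Label}
    (h : w ∈ (G.annotated δ I).STR) : w.map AnnotatedLabel.forget ∈ G.STR := by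
  obtain ⟨H, hH, hw⟩ := h
  exact ⟨H.forget, (mem_language_annotated_iff.1 hH).1, hw.mapLabel _ _⟩

theorem GeneratesStringGraphs.annotated (h : G.GeneratesStringGraphs) :
    (G.annotated δ I).GeneratesStringGraphs := by
  intro H hH
  obtain ⟨hG, hp, -⟩ := mem_language_annotated_iff.1 hH
  obtain ⟨w, hw⟩ := h _ hG
  have hw' := hw.mapLabel (D := annotatedSignature G.sig Q) .plain fun _ => rfl
  -- All labels of `H` are plain, so no information was forgotten.
  have heq : (H.forget.mapLabel (D := annotatedSignature G.sig Q) .plain fun _ => rfl) = H :=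
    relabel_eq_self (C := annotatedSignature G.sig Q) H _ _ (funext fun e => (hp e).symm)
  exact ⟨_, heq ▸ hw'⟩

theorem map_plain_mem_STR_annotated {p : Q} {w : List G.sig.Label} {F : Set Q}
    (hG : w ∈ G.STR) (h : ∃ r ∈ F, LabelledPath δ p w r) :
    w.map AnnotatedLabel.plain ∈ (G.annotated δ {qs | ∃ r ∈ F, qs = [p, r]}).STR := by
  obtain ⟨H, hH, hw⟩ := hG
  obtain ⟨r, hr, h⟩ := h
  obtain ⟨f, hf, hδ⟩ := (hw.labelledPath_iff δ p r).1 h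
  exact ⟨H.mapLabel (D := annotatedSignature G.sig Q) .plain fun _ => rfl,
    mem_language_annotated_iff.2 ⟨hH, fun _ => rfl, f, ⟨r, hr, hf⟩, hδ⟩,
    hw.mapLabel (D := annotatedSignature G.sig Q) .plain fun _ => rfl⟩

theorem exists_labelledPath_of_mem_STR_annotated {p : Q} {F : Set Q}
    {w : List (AnnotatedLabel G.sig Q)}
    (h : w ∈ (G.annotated δ {qs | ∃ r ∈ F, qs = [p, r]}).STR) :
    ∃ r ∈ F, LabelledPath δ p (w.map AnnotatedLabel.forget) r := by
  obtain ⟨H, hH, hw⟩ := h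
  obtain ⟨hG, hp, f, ⟨r, hr, hf⟩, hδ⟩ := mem_language_annotated_iff.1 hH
  exact ⟨r, hr, ((hw.mapLabel (D := G.sig) AnnotatedLabel.forget fun _ => rfl).labelledPath_iff
    δ p r).2 ⟨f, hf, hδ⟩⟩

/-- The annotated grammar for a deterministic automaton generates the intersection of the
language of a grammar and the language of the automaton, both read over a common alphabet. -/
theorem GeneratesStrings.annotated {α A B : Type*} {L : Language A} (h : G.GeneratesStrings L)
    (ι : A ↪ α) (φ : B → α) (M : DFA B Q) :
    ∃ δ I, (G.annotated (Q := Q) δ I).GeneratesStrings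
      (Language.map ι L ⊓ Language.map φ M.accepts) := by
  obtain ⟨hG, name, hname⟩ := h
  let δ := G.terminalStep (fun X => ι (name X)) φ M
  -- The two external nodes are the ends of the string, where the run starts and accepts.
  let I : Set (List Q) := {qs | ∃ r ∈ M.accept, qs = [M.start, r]}
  -- New terminals are the plain copies of old ones, so they inherit the old names injectively.
  let e : (G.annotated δ I).terminals → G.terminals := fun X => ⟨AnnotatedLabel.forget X.1, by
    obtain ⟨_, Y, hY, rfl⟩ := X
    exact hY⟩
  have he : Function.Injective e := by
    rintro ⟨_, Y, hY, rfl⟩ ⟨_, Z, hZ, rfl⟩ h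
    obtain rfl : Y = Z := congrArg Subtype.val h
    rfl
  let e' : G.terminals → (G.annotated δ I).terminals := fun X => ⟨.plain X.1, X.1, X.2, rfl⟩
  refine ⟨δ, I, hG.annotated, ⟨fun X => ι (name (e X)), fun X Y h => he (name.injective
    (ι.injective h))⟩, Set.ext fun w => ⟨?_, ?_⟩⟩
  · rintro ⟨v, hv, rfl⟩
    have hev : (v.map e).map Subtype.val = (v.map Subtype.val).map AnnotatedLabel.forget :=
      List.map_map.trans (List.map_map (f := Subtype.val) (g := AnnotatedLabel.forget)).symm
    have hv₁ : (v.map e).map Subtype.val ∈ G.STR :=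
      hev ▸ forget_mem_STR_of_mem_STR_annotated hv
    have hv₂ := (Set.ext_iff.1 hname ((v.map e).map name)).1 ⟨v.map e, hv₁, rfl⟩
    have hv₃ := exists_labelledPath_of_mem_STR_annotated hv
    have hv₄ := (labelledPath_terminalStep_iff (fun X => ι (name X)) φ M (v.map e)).1 (hev ▸ hv₃)
    refine ⟨⟨⟨_, hv₂.1, ?_⟩, ?_⟩, ?_⟩
    · simp only [List.map_map]
      rfl
    · rw [List.map_map] at hv₄
      exact hv₄
    · simpa using hv₂.2
  · rintro ⟨⟨⟨u, hu, rfl⟩, hK⟩, hne⟩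
    obtain ⟨v, hv, rfl⟩ := (Set.ext_iff.1 hname u).2 ⟨hu, by simpa using hne⟩
    refine ⟨v.map e', ?_, ?_⟩
    · have := map_plain_mem_STR_annotated hv
        ((labelledPath_terminalStep_iff (fun X => ι (name X)) φ M v).2 (by
          rw [List.map_map] at hK
          exact hK))
      rw [List.map_map] at this ⊢
      exact this
    · simp only [List.map_map]
      rfl

end PHRGrammar

theorem mainTheorem8 {α : Type*} (A B : Finset α) (L : Language A) (K : Language B)
    (hK : K.IsRegular) (k l : ℕ) (hk : 2 ≤ k) (hl : 1 ≤ l) :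
    (IsPHRS k l L →
      IsPHRS k l (Language.map (Subtype.val : A → α) L ⊓ Language.map (Subtype.val : B → α) K)) ∧
    (IsRepetitionFreePHRS k l L →
      IsRepetitionFreePHRS k l
        (Language.map (Subtype.val : A → α) L ⊓ Language.map (Subtype.val : B → α) K)) := by
  obtain ⟨Q, _, M, rfl⟩ := hK
  constructor
  · rintro ⟨G, ho, hG⟩
    obtain ⟨δ, I, h⟩ := hG.annotated (Function.Embedding.subtype _) Subtype.val M
    exact ⟨_, ho.annotated, h⟩
  · rintro ⟨G, ho, hr, hG⟩
    obtain ⟨δ, I, h⟩ := hG.annotated (Function.Embedding.subtype _) Subtype.val M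
    exact ⟨_, ho.annotated, hr.annotated, h⟩
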